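/- Let $\mathbb{F}_q$ be a finite field, let $s\ge 0$ and let $m$ be an integer with $\gcd(m,q)=1$. Write vectors of $\mathbb{F}_q^{sm}$ as $c=(c_{i,k})_{1\le i\le s,\,0\le k<m}$. Let $\sigma$ be the permutation of the coordinates that shifts each of the $s$ blocks cyclically, and let $C\subseteq\mathbb{F}_q^{sm}$ be a quasi-cyclic code of length $sm$ and index $s$, that is, a $\sigma$-invariant linear code. Let $C_\pi\subseteq\mathbb{F}_q^s$ be the projection of the fixed subcode $F_\sigma(C)=\{v\in C: v\sigma=v\}$: each $v\in F_\sigma(C)$ is constant on every block and is sent to the vector of its $s$ block values. Let $\mathcal{R}_m=\mathbb{F}_q[x]/(x^m-1)$, with the conjugation $\overline{v(x)}=v(x^{-1})=v(x^{m-1})$, and let $\phi:\mathbb{F}_q^{sm}\to\mathcal{R}_m^s$ be the map $\phi(c)=\bigl(\sum_k c_{i,k}x^k\bigr)_{1\le i\le s}$. Let $$x^m-1=\delta\, g_0g_1\cdots g_r\,h_1h_1^*\cdots h_th_t^*$$ with $\delta\in\mathbb{F}_q^*$, $g_0=x-1$, all $g_i,h_j\in\mathbb{F}_q[x]$ irreducible,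 each $g_i$ associated with its reciprocal polynomial, and $h_j^*$ the reciprocal polynomial of $h_j$. Let $G_i$, $H_j'$, $H_j''$ be the minimal ideals of $\mathcal{R}_m$ generated by $\frac{x^m-1}{g_i}$, $\frac{x^m-1}{h_j}$, $\frac{x^m-1}{h_j^*}$, respectively. The constituents of $C$ are $C_i=\phi(C)\cap G_i^s$, $C_j'=\phi(C)\cap (H_j')^s$ and $C_j''=\phi(C)\cap (H_j'')^s$; they are the summands in $\phi(C)=\bigoplus_i C_i\oplus\bigoplus_j (C_j'\oplus C_j'')$. Then $C_\pi=C_0$, where $G_0$ is identified with $\mathbb{F}_q$ by $v(x)\mapsto v(1)$. Moreover, $C$ is Euclidean self-orthogonal if and only if all of the following hold: (a) $C_\pi$ is Euclidean self-orthogonal; (b) for $i=1,\dots,r$, the code $C_i$ over $G_i$ is self-orthogonal with respect to the Hermitian inner product $\sum_k u_k\overline{v_k}$; (c) for $j=1,\dots,t$, $C_j''\subseteq (C_j')^\perp$, where $H_j''$ is identified with $H_j'$ by the conjugation. That is, $\overline{C_j''}=\{\overline{u}:u\in C_j''\}$ is contained in the Euclidean dual $(C_j')^\perp=\{w\in (H_j')^s:\sum_k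 w_kv_k=0\text{ for all }v\in C_j'\}$. -/

import Mathlib

open Polynomial

namespace QuasiCyclic

/-! ### Linear codes with the Euclidean inner product -/

section Linear

variable {F : Type*} [Field F] {ι : Type*} [Fintype ι]

/-- The dual code with respect to the Euclidean inner product `u ⬝ᵥ v = ∑ i, u i * v i`. -/
def euclideanDual (C : Submodule F (ι → F)) : Submodule F (ι → F) where
  carrier := {u | ∀ v ∈ C, u ⬝ᵥ v = 0}
  add_mem' := fun {a b} ha hb v hv => by rw [add_dotProduct, ha v hv, hb v hv, add_zero]
  zero_mem' := fun v _ => zero_dotProduct v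
  smul_mem' := fun c u hu v hv => by rw [smul_dotProduct, hu v hv, smul_zero]

/-- Euclidean self-orthogonality: `C ⊆ C^⊥`. -/
def IsEuclideanSelfOrthogonal (C : Submodule F (ι → F)) : Prop :=
  C ≤ euclideanDual C

end Linear

/-! ### Quasi-cyclic codes of length `s * m` and index `s`

The coordinates are indexed by `Fin s × Fin m`: the coordinate `(i, k)` is the `k`-th one in the
`i`-th block (cycle) of length `m`. -/

section Code

variable {F : Type*} [Field F] {s m : ℕ}

/-- The permutation `σ`, with `s` disjoint cycles of length `m`. -/
def blockShift (s m : ℕ) : Equiv.Perm (Fin s × Fin m) :=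
  Equiv.prodCongrRight fun _ => finRotate m

/-- A linear code is quasi-cyclic if `σ` is a permutation automorphism of it. -/
def IsQuasiCyclic (C : Submodule F (Fin s × Fin m → F)) : Prop :=
  ∀ c ∈ C, c ∘ blockShift s m ∈ C

/-- The fixed subcode `F_σ(C) = {v ∈ C | v σ = v}`. -/
def fixedSubcode (C : Submodule F (Fin s × Fin m → F)) : Submodule F (Fin s × Fin m → F) where
  carrier := {v | v ∈ C ∧ v ∘ blockShift s m = v}
  add_mem' := fun {a b} ha hb =>
    ⟨C.add_mem ha.1 hb.1, by
      funext p
      exact congrArg₂ (· + ·) (congrFun ha.2 p) (congrFun hb.2 p)⟩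
  zero_mem' := ⟨C.zero_mem, rfl⟩
  smul_mem' := fun c v hv =>
    ⟨C.smul_mem c hv.1, by
      funext p
      exact congrArg (c * ·) (congrFun hv.2 p)⟩

/-- The projection code `C_π = π(F_σ(C))` of length `s`: `π` sends a word of the fixed subcode,
which is constant on each block, to the vector of its values on the blocks. -/
def projectionCode (C : Submodule F (Fin s × Fin m → F)) : Submodule F (Fin s → F) where
  carrier := {a | ∃ v ∈ fixedSubcode C, ∀ i k, v (i, k) = a i}
  add_mem' := by
    rintro a b ⟨v, hv, hva⟩ ⟨w, hw, hwb⟩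
    exact ⟨v + w, add_mem hv hw, fun i k => congrArg₂ (· + ·) (hva i k) (hwb i k)⟩
  zero_mem' := ⟨0, zero_mem _, fun _ _ => rfl⟩
  smul_mem' := by
    rintro c a ⟨v, hv, hva⟩
    exact ⟨c • v, Submodule.smul_mem _ c hv, fun i k => congrArg (c * ·) (hva i k)⟩

end Code

/-! ### The ring `R_m = F[x] / (x ^ m - 1)` -/

section Ring

/-- `R_m = F[x] / (x ^ m - 1)`. -/
abbrev CyclicRing (F : Type*) [Field F] (m : ℕ) : Type _ :=
  AdjoinRoot (X ^ m - 1 : F[X])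

variable (F : Type*) [Field F] (m : ℕ)

/-- The class of `x` in `R_m`. -/
noncomputable def xbar : CyclicRing F m := AdjoinRoot.root (X ^ m - 1 : F[X])

theorem xbar_pow : xbar F m ^ m = 1 := by
  have h : aeval (xbar F m) (X ^ m - 1 : F[X]) = 0 := by
    rw [xbar, AdjoinRoot.aeval_eq, AdjoinRoot.mk_self]
  simpa [sub_eq_zero] using h

/-- The conjugation `v(x) ↦ v(x⁻¹) = v(x ^ (m - 1))` of `R_m`. -/
noncomputable def conj : CyclicRing F m →ₐ[F] CyclicRing F m :=
  AdjoinRoot.liftAlgHom (X ^ m - 1 : F[X]) (Algebra.ofId F (CyclicRing F m))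
    (xbar F m ^ (m - 1)) (by
      have h : (xbar F m ^ (m - 1)) ^ m = 1 := by
        rw [← pow_mul, mul_comm, pow_mul, xbar_pow, one_pow]
      simp [h])

/-- The evaluation `v(x) ↦ v(1)`. It restricts to the isomorphism of the ideal generated by
`(x ^ m - 1) / (x - 1)` with `F[x] / (x - 1) ≅ F`. -/
noncomputable def evalOne : CyclicRing F m →ₐ[F] F :=
  AdjoinRoot.liftAlgHom (X ^ m - 1 : F[X]) (AlgHom.id F F) 1 (by simp)

variable {F}

/-- The ideal of `R_m` generated by `(x ^ m - 1) / f`, for a divisor `f` of `x ^ m - 1`; it is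
isomorphic to `F[x] / (f)` if `m` is prime to the characteristic. -/
noncomputable def minIdeal (f : F[X]) : Ideal (CyclicRing F m) :=
  Ideal.span {AdjoinRoot.mk (X ^ m - 1 : F[X]) ((X ^ m - 1) / f)}

/-- The space `I ^ s` of the vectors of length `s` with all entries in the ideal `I` of `R_m`. -/
def idealPow {m : ℕ} (I : Ideal (CyclicRing F m)) (s : ℕ) :
    Submodule F (Fin s → CyclicRing F m) where
  carrier := {u | ∀ i, u i ∈ I}
  add_mem' := fun ha hb i => I.add_mem (ha i) (hb i)
  zero_mem' := fun _ => I.zero_mem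
  smul_mem' := fun c u hu i => by
    rw [Pi.smul_apply, Algebra.smul_def]
    exact I.mul_mem_left _ (hu i)

end Ring

/-! ### Constituents and inner products over the minimal ideals -/

section Constituents

variable {F : Type*} [Field F] {s m : ℕ}

/-- The map `φ`, which sends `c` to the vector of the polynomials
`c (i, 0) + c (i, 1) x + ⋯ + c (i, m - 1) x ^ (m - 1)`. -/
noncomputable def phi : (Fin s × Fin m → F) →ₗ[F] (Fin s → CyclicRing F m) where
  toFun c i := ∑ k : Fin m, c (i, k) • xbar F m ^ (k : ℕ)
  map_add' a b := by
    funext i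
    simp [add_smul, Finset.sum_add_distrib]
  map_smul' a b := by
    funext i
    simp [Finset.smul_sum, smul_smul]

/-- The constituent of `C` at the minimal ideal `I` that is generated by `(x ^ m - 1) / f`, that
is, the summand `φ(C) ∩ I ^ s` of `φ(C)` in the decomposition of `R_m ^ s` as the direct sum of
the `I ^ s`. -/
noncomputable def constituent (C : Submodule F (Fin s × Fin m → F)) (f : F[X]) :
    Submodule F (Fin s → CyclicRing F m) :=
  C.map phi ⊓ idealPow (minIdeal m f) s

/-- The code over `F` of length `s` that is obtained from `D` by entrywise evaluation at `x = 1`. -/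
noncomputable def evalOneCode (D : Submodule F (Fin s → CyclicRing F m)) :
    Submodule F (Fin s → F) :=
  D.map ((evalOne F m).toLinearMap.compLeft (Fin s))

/-- The code of the entrywise conjugates of the words of `D`. -/
noncomputable def conjCode (D : Submodule F (Fin s → CyclicRing F m)) :
    Submodule F (Fin s → CyclicRing F m) :=
  D.map ((conj F m).toLinearMap.compLeft (Fin s))

/-- The Euclidean dual, inside `I ^ s`, of a code `D` of length `s` over `I`. -/
def euclideanDualIn (I : Ideal (CyclicRing F m)) (D : Submodule F (Fin s → CyclicRing F m)) :
    Submodule F (Fin s → CyclicRing F m) where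
  carrier := {u | u ∈ idealPow I s ∧ ∀ v ∈ D, ∑ i, u i * v i = 0}
  add_mem' := fun {a b} ha hb => ⟨add_mem ha.1 hb.1, fun v hv => by
    simp [add_mul, Finset.sum_add_distrib, ha.2 v hv, hb.2 v hv]⟩
  zero_mem' := ⟨zero_mem _, fun v _ => by simp⟩
  smul_mem' := fun c u hu => ⟨Submodule.smul_mem _ c hu.1, fun v hv => by
    simp [← Finset.smul_sum, hu.2 v hv]⟩

/-- The dual, inside `I ^ s`, of a code `D` of length `s` over `I` with respect to the Hermitian
inner product `∑ i, u i * conj (v i)`. -/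
noncomputable def hermitianDualIn (I : Ideal (CyclicRing F m))
    (D : Submodule F (Fin s → CyclicRing F m)) : Submodule F (Fin s → CyclicRing F m) where
  carrier := {u | u ∈ idealPow I s ∧ ∀ v ∈ D, ∑ i, u i * conj F m (v i) = 0}
  add_mem' := fun {a b} ha hb => ⟨add_mem ha.1 hb.1, fun v hv => by
    simp [add_mul, Finset.sum_add_distrib, ha.2 v hv, hb.2 v hv]⟩
  zero_mem' := ⟨zero_mem _, fun v _ => by simp⟩
  smul_mem' := fun c u hu => ⟨Submodule.smul_mem _ c hu.1, fun v hv => by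
    simp [← Finset.smul_sum, hu.2 v hv]⟩

end Constituents

end QuasiCyclic

namespace QuasiCyclic

/-! ### Conjugation, reversal and the minimal ideals of `R_m`. -/

section RingLemmas

variable {F : Type*} [Field F] {m : ℕ}

/-! The coefficient of `x ^ l` in the Hermitian form of `φ(c)` and `φ(d)` is the Euclidean product
of `d` with `c` shifted by `l` (`hermitianForm_phi`). Since the code is shift-invariant, it is
self-orthogonal iff the form vanishes on `φ(C)`.

As `m ≠ 0` in `F`, `x ^ m - 1` is squarefree, so a value of the form, represented by `p`, vanishes
iff every irreducible factor divides `p`. This can be tested on constituents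
(`dvd_of_hermitianForm_constituent`). If `x ^ m - 1 = f q`, multiplying `u` by `q` and `v` by `conj
q` moves them into the constituents at `f` and at its reciprocal, and multiplies the form by `q ^
2`. If the result is zero, then `f ∣ p`, because `f` and `q` are coprime. So only the pairings of
`f` with its reciprocal matter: `g_i` pairs with itself, `h_j` with `h_j^*`.

At `x - 1` the ideal is the line spanned by `1 + x + ⋯ + x ^ (m - 1)`. Evaluation at `1` is
injective there, which gives both `C_π = C_0` and condition (a). -/

theorem pow_sub_one_mul_xbar [NeZero m] : xbar F m ^ (m - 1) * xbar F m = 1 := by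
  rw [← pow_succ, Nat.sub_add_cancel NeZero.one_le, xbar_pow]

theorem conj_xbar : conj F m (xbar F m) = xbar F m ^ (m - 1) :=
  AdjoinRoot.liftAlgHom_root ..

theorem conj_xbar_pow_mul [NeZero m] (k : ℕ) :
    conj F m (xbar F m ^ k) * xbar F m ^ k = 1 := by
  rw [map_pow, conj_xbar, ← mul_pow, pow_sub_one_mul_xbar, one_pow]

theorem conj_conj [NeZero m] (a : CyclicRing F m) : conj F m (conj F m a) = a := by
  suffices h : (conj F m).comp (conj F m) = AlgHom.id F _ from DFunLike.congr_fun h a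
  refine AdjoinRoot.algHom_ext ?_
  change conj F m (conj F m (xbar F m)) = xbar F m
  have h := conj_xbar_pow_mul (F := F) (m := m) 1
  rw [pow_one] at h
  -- Both `x` and its double conjugate are inverse to `conj x`, hence equal.
  have h' : conj F m (conj F m (xbar F m)) * conj F m (xbar F m) = 1 := by
    rw [← map_mul, h, map_one]
  linear_combination xbar F m * h' - conj F m (conj F m (xbar F m)) * h

theorem evalOne_xbar : evalOne F m (xbar F m) = 1 :=
  AdjoinRoot.liftAlgHom_root ..

theorem evalOne_conj (a : CyclicRing F m) : evalOne F m (conj F m a) = evalOne F m a := by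
  suffices h : (evalOne F m).comp (conj F m) = evalOne F m from DFunLike.congr_fun h a
  refine AdjoinRoot.algHom_ext ?_
  change evalOne F m (conj F m (xbar F m)) = evalOne F m (xbar F m)
  rw [conj_xbar, map_pow, evalOne_xbar, one_pow]

theorem xbar_pow_mod (a : ℕ) : xbar F m ^ (a % m) = xbar F m ^ a := by
  conv_rhs => rw [← Nat.mod_add_div a m, pow_add, pow_mul, xbar_pow, one_pow, mul_one]

theorem xbar_pow_add (a b : Fin m) :
    xbar F m ^ ((a + b : Fin m) : ℕ) = xbar F m ^ (a : ℕ) * xbar F m ^ (b : ℕ) := by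
  rw [Fin.val_add, xbar_pow_mod, pow_add]

/-- Up to a unit power of `x`, substituting `x⁻¹` reverses the polynomial; hence conjugation carries
the ideal at `f` to the one at `f.reverse`. -/
theorem conj_mk [NeZero m] (p : F[X]) :
    conj F m (AdjoinRoot.mk _ p) =
      AdjoinRoot.mk _ p.reverse * (xbar F m ^ (m - 1)) ^ p.natDegree := by
  let : Invertible (xbar F m ^ (m - 1)) :=
    ⟨xbar F m, (mul_comm _ _).trans pow_sub_one_mul_xbar, pow_sub_one_mul_xbar⟩
  have h := eval₂_reverse_mul_pow (algebraMap F (CyclicRing F m)) (xbar F m ^ (m - 1)) p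
  have h1 : conj F m (AdjoinRoot.mk _ p) =
      eval₂ (algebraMap F (CyclicRing F m)) (xbar F m ^ (m - 1)) p := rfl
  have h2 : (AdjoinRoot.mk (X ^ m - 1 : F[X]) p.reverse : CyclicRing F m) =
      eval₂ (algebraMap F (CyclicRing F m)) (xbar F m) p.reverse :=
    (AdjoinRoot.aeval_eq _).symm
  rw [h1, h2]
  exact h.symm

theorem minIdeal_eq_span [NeZero m] {f q : F[X]} (hfq : X ^ m - 1 = f * q) :
    minIdeal m f = Ideal.span {AdjoinRoot.mk (X ^ m - 1 : F[X]) q} := by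
  have hf : f ≠ 0 := by
    rintro rfl
    exact X_pow_sub_C_ne_zero (NeZero.pos m) (1 : F) (by simpa using hfq)
  rw [minIdeal]
  congr 3
  conv_lhs => rw [hfq]
  exact mul_div_cancel_left₀ q hf

theorem minIdeal_congr [NeZero m] {f f' : F[X]} (hf : f ∣ X ^ m - 1) (h : Associated f f') :
    minIdeal m f = minIdeal m f' := by
  obtain ⟨q, hq⟩ := hf
  obtain ⟨u, rfl⟩ := h
  have hq' : (X ^ m - 1 : F[X]) = f * u * (((u⁻¹ : F[X]ˣ) : F[X]) * q) := by
    rw [hq, mul_assoc, Units.mul_inv_cancel_left]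
  rw [minIdeal_eq_span hq, minIdeal_eq_span hq', map_mul,
    Ideal.span_singleton_mul_left_unit ((u⁻¹).isUnit.map _)]

theorem reverse_X_pow_sub_one [NeZero m] :
    (X ^ m - 1 : F[X]).reverse = -(X ^ m - 1) := by
  have h : (X ^ m - 1 : F[X]).natDegree = m := natDegree_X_pow_sub_C (r := (1 : F))
  have h1 : reflect m (1 : F[X]) = X ^ m := by
    simp
  have h2 : reflect m (X ^ m : F[X]) = 1 := by
    rw [← h1]; ext; simp
  rw [reverse, h, reflect_sub, h1, h2, neg_sub]

theorem eq_reverse_mul_neg_reverse [NeZero m] {f q : F[X]} (hfq : X ^ m - 1 = f * q) :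
    (X ^ m - 1 : F[X]) = f.reverse * (-q.reverse) := by
  rw [mul_neg, ← reverse_mul_of_domain, ← hfq, reverse_X_pow_sub_one, neg_neg]

/-- Reversal forgets factors `X`, and a divisor of `x ^ m - 1` has none; it then agrees with the
involution `mirror`. -/
theorem reverse_reverse_of_dvd [NeZero m] {f : F[X]} (hf : f ∣ X ^ m - 1) :
    f.reverse.reverse = f := by
  have h0 : f.natTrailingDegree = 0 := by
    rw [natTrailingDegree_eq_zero]
    right
    intro h
    have h' : (X : F[X]) ∣ X ^ m - 1 := (X_dvd_iff.2 h).trans hf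
    rw [X_dvd_iff] at h'
    simp [(NeZero.ne m).symm] at h'
  have h1 : f.mirror = f.reverse := by rw [mirror, h0, pow_zero, mul_one]
  have h2 : f.reverse.mirror = f.reverse.reverse := by
    rw [mirror, natTrailingDegree_reverse, pow_zero, mul_one]
  rw [← h2, ← h1, mirror_mirror]

theorem conj_mem_minIdeal_reverse [NeZero m] {f : F[X]} (hf : f ∣ X ^ m - 1)
    {a : CyclicRing F m} (ha : a ∈ minIdeal m f) : conj F m a ∈ minIdeal m f.reverse := by
  obtain ⟨q, hq⟩ := hf
  rw [minIdeal_eq_span hq, Ideal.mem_span_singleton] at ha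
  rw [minIdeal_eq_span (eq_reverse_mul_neg_reverse hq), Ideal.mem_span_singleton, map_neg,
    neg_dvd]
  obtain ⟨b, rfl⟩ := ha
  rw [map_mul, conj_mk, mul_assoc]
  exact dvd_mul_right _ _

/-- The element `1 + x + ⋯ + x ^ (m - 1)`, which generates the minimal ideal at `x - 1`. -/
noncomputable def allOnes (F : Type*) [Field F] (m : ℕ) : CyclicRing F m :=
  ∑ k : Fin m, xbar F m ^ (k : ℕ)

theorem evalOne_allOnes : evalOne F m (allOnes F m) = m := by
  simp [allOnes, evalOne_xbar]

theorem mem_minIdeal_X_sub_one_iff [NeZero m] {a : CyclicRing F m} :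
    a ∈ minIdeal m (X - 1) ↔ ∃ c : F, a = c • allOnes F m := by
  have hq : (X ^ m - 1 : F[X]) = (X - 1) * ∑ k ∈ Finset.range m, X ^ k :=
    (mul_geom_sum X m).symm
  have hN : (AdjoinRoot.mk (X ^ m - 1 : F[X]) (∑ k ∈ Finset.range m, X ^ k)) = allOnes F m := by
    rw [allOnes, Fin.sum_univ_eq_sum_range (fun k => xbar F m ^ k), map_sum]
    exact Finset.sum_congr rfl fun k _ => map_pow _ _ _
  rw [minIdeal_eq_span hq, Ideal.mem_span_singleton, hN]
  constructor
  · rintro ⟨b, rfl⟩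
    obtain ⟨p, rfl⟩ := AdjoinRoot.mk_surjective b
    -- Modulo `x - 1` the multiplier `p` is the constant `p(1)`, and `x - 1` annihilates `allOnes`.
    refine ⟨p.eval 1, ?_⟩
    have hC : algebraMap F (CyclicRing F m) (p.eval 1) = AdjoinRoot.mk _ (C (p.eval 1)) := rfl
    rw [Algebra.smul_def, mul_comm, ← sub_eq_zero, ← sub_mul, ← hN, hC, ← map_sub, ← map_mul,
      AdjoinRoot.mk_eq_zero, hq]
    have hd : (X - C 1 : F[X]) ∣ p - C (p.eval 1) := X_sub_C_dvd_sub_C_eval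
    exact mul_dvd_mul_right (by simpa using hd) _
  · rintro ⟨c, rfl⟩
    exact ⟨algebraMap _ _ c, by rw [Algebra.smul_def, mul_comm]⟩

theorem eq_zero_of_evalOne_eq_zero [NeZero m] (hm : (m : F) ≠ 0) {a : CyclicRing F m}
    (ha : a ∈ minIdeal m (X - 1)) (h : evalOne F m a = 0) : a = 0 := by
  obtain ⟨c, rfl⟩ := mem_minIdeal_X_sub_one_iff.1 ha
  rw [map_smul, evalOne_allOnes, smul_eq_mul, mul_eq_zero, or_iff_left hm] at h
  rw [h, zero_smul]

end RingLemmas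

/-! ### Coefficient vectors, shifts and correlations. -/

section Blocks

variable {F : Type*} [Field F] {s m : ℕ}

/-- The class in `R_m` of the polynomial with the coefficients `a 0, …, a (m - 1)`. -/
noncomputable def blockPoly (a : Fin m → F) : CyclicRing F m :=
  ∑ k : Fin m, a k • xbar F m ^ (k : ℕ)

theorem phi_apply (c : Fin s × Fin m → F) (i : Fin s) :
    phi c i = blockPoly fun k => c (i, k) := rfl

theorem blockPoly_injective [NeZero m] : Function.Injective (blockPoly : (Fin m → F) → _) := by
  intro a b hab
  have key : ∀ c : Fin m → F,
      blockPoly c = AdjoinRoot.mk (X ^ m - 1 : F[X]) (∑ k : Fin m, C (c k) * X ^ (k : ℕ)) := by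
    intro c
    rw [blockPoly, map_sum]
    refine Finset.sum_congr rfl fun k _ => ?_
    rw [Algebra.smul_def, map_mul, map_pow]
    rfl
  rw [key, key, ← sub_eq_zero, ← map_sub, AdjoinRoot.mk_eq_zero, ← Finset.sum_sub_distrib] at hab
  have hdeg : (∑ k : Fin m, (C (a k) * X ^ (k : ℕ) - C (b k) * X ^ (k : ℕ))).degree <
      (X ^ m - 1 : F[X]).degree := by
    have h1 : (X ^ m - 1 : F[X]).degree = m := degree_X_pow_sub_C (NeZero.pos m) (1 : F)
    rw [h1, ← mem_degreeLT]
    refine Submodule.sum_mem _ fun k _ => ?_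
    rw [← sub_mul, ← C_sub, mem_degreeLT]
    exact (degree_C_mul_X_pow_le _ _).trans_lt (by exact_mod_cast k.2)
  have h0 := eq_zero_of_dvd_of_degree_lt hab hdeg
  funext l
  have h1 := congrArg (fun p => coeff p (l : ℕ)) h0
  simpa [coeff_X_pow, Fin.val_inj, Finset.sum_sub_distrib, sub_eq_zero] using h1

theorem phi_injective [NeZero m] :
    Function.Injective (phi : (Fin s × Fin m → F) →ₗ[F] (Fin s → CyclicRing F m)) := by
  intro c d h
  funext ⟨i, k⟩
  exact congrFun (blockPoly_injective (congrFun h i)) k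

theorem blockPoly_shift [NeZero m] (a : Fin m → F) (l : Fin m) :
    (blockPoly fun k => a (k - l)) = xbar F m ^ (l : ℕ) * blockPoly a := by
  rw [blockPoly, blockPoly, Finset.mul_sum,
    ← Equiv.sum_comp (Equiv.addRight l) fun k => a (k - l) • xbar F m ^ (k : ℕ)]
  refine Finset.sum_congr rfl fun k _ => ?_
  simp only [Equiv.coe_addRight, add_sub_cancel_right, xbar_pow_add, mul_smul_comm, mul_comm]

/-- Since `x ^ (k + l) * conj (x ^ k) = x ^ l`, the product collects cyclic correlations. -/
theorem blockPoly_mul_conj [NeZero m] (a b : Fin m → F) :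
    blockPoly a * conj F m (blockPoly b) = blockPoly fun l => ∑ k, a (k + l) * b k := by
  simp only [blockPoly, map_sum, Finset.sum_mul, Finset.mul_sum, map_smul, Finset.sum_smul]
  conv_rhs => rw [Finset.sum_comm]
  refine Finset.sum_congr rfl fun k _ => ?_
  refine (Equiv.sum_comp (Equiv.addLeft k) _).symm.trans ?_
  refine Finset.sum_congr rfl fun l _ => ?_
  have h : xbar F m ^ (k : ℕ) * xbar F m ^ (l : ℕ) * conj F m (xbar F m ^ (k : ℕ)) =
      xbar F m ^ (l : ℕ) := by
    linear_combination (xbar F m ^ (l : ℕ)) * conj_xbar_pow_mul (F := F) (m := m) k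
  simp only [Equiv.coe_addLeft, xbar_pow_add, smul_mul_smul_comm, h]

theorem IsQuasiCyclic.shift_mem [NeZero m] {K : Submodule F (Fin s × Fin m → F)}
    (hK : IsQuasiCyclic K) {c : Fin s × Fin m → F} (hc : c ∈ K) (l : Fin m) :
    (fun p => c (p.1, p.2 + l)) ∈ K := by
  have h : ∀ n : ℕ, (fun p : Fin s × Fin m => c (p.1, p.2 + Fin.ofNat m n)) ∈ K := by
    intro n
    induction n with
    | zero => simpa using hc
    | succ n ih =>
      convert hK _ ih using 1
      funext ⟨i, k⟩
      simp only [Function.comp, blockShift, Equiv.prodCongrRight_apply, finRotate_apply]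
      congr 2
      apply Fin.ext
      simp [Fin.val_add]
      congr 1
      ring
  simpa using h l

end Blocks

/-! ### The Hermitian form, tested one factor at a time. -/

section Form

variable {F : Type*} [Field F] {s m : ℕ}

/-- The Hermitian form `∑ i, u i * conj (v i)` on `R_m ^ s`. -/
noncomputable def hermitianForm (u v : Fin s → CyclicRing F m) : CyclicRing F m :=
  ∑ i, u i * conj F m (v i)

theorem hermitianForm_phi [NeZero m] (c d : Fin s × Fin m → F) :
    hermitianForm (phi c) (phi d) =
      blockPoly fun l => (fun p : Fin s × Fin m => c (p.1, p.2 + l)) ⬝ᵥ d := by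
  simp only [hermitianForm, phi_apply, blockPoly_mul_conj, dotProduct, Fintype.sum_prod_type]
  simp only [blockPoly, Finset.sum_smul (f := fun i => ∑ k, _)]
  exact Finset.sum_comm

theorem isEuclideanSelfOrthogonal_iff_hermitianForm [NeZero m]
    {K : Submodule F (Fin s × Fin m → F)} (hK : IsQuasiCyclic K) :
    IsEuclideanSelfOrthogonal K ↔
      ∀ u ∈ K.map phi, ∀ v ∈ K.map phi, hermitianForm u v = 0 := by
  have h0 : blockPoly (0 : Fin m → F) = 0 := by simp [blockPoly]
  constructor
  · rintro h _ ⟨c, hc, rfl⟩ _ ⟨d, hd, rfl⟩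
    rw [hermitianForm_phi, ← h0]
    congr 1
    funext l
    exact h (hK.shift_mem hc l) d hd
  · intro h c hc d hd
    have h1 := h _ ⟨c, hc, rfl⟩ _ ⟨d, hd, rfl⟩
    rw [hermitianForm_phi, ← h0] at h1
    -- The constant coefficient `l = 0` is the unshifted Euclidean product.
    simpa using congrFun (blockPoly_injective h1) 0

/-- Multiplication by `x ^ n` is a cyclic shift of every block, so `φ(C)` is an `R_m`-submodule. -/
theorem IsQuasiCyclic.smul_mem_map_phi [NeZero m] {K : Submodule F (Fin s × Fin m → F)}
    (hK : IsQuasiCyclic K) (a : CyclicRing F m) {u : Fin s → CyclicRing F m}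
    (hu : u ∈ K.map phi) : a • u ∈ K.map phi := by
  obtain ⟨p, rfl⟩ := AdjoinRoot.mk_surjective a
  obtain ⟨c, hc, rfl⟩ := hu
  induction p using Polynomial.induction_on' with
  | add p q hp hq => rw [map_add, add_smul]; exact add_mem hp hq
  | monomial n a =>
    refine ⟨a • fun p => c (p.1, p.2 + -Fin.ofNat m n),
      K.smul_mem a (hK.shift_mem hc _), ?_⟩
    rw [map_smul]
    funext i
    have h := blockPoly_shift (fun k => c (i, k)) (Fin.ofNat m n)
    simp only [Pi.smul_apply, phi_apply, ← sub_eq_add_neg, smul_eq_mul]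
    rw [h, Fin.val_ofNat, xbar_pow_mod, ← C_mul_X_pow_eq_monomial, map_mul, map_pow,
      Algebra.smul_def, mul_assoc]
    rfl

theorem smul_mem_constituent [NeZero m] {K : Submodule F (Fin s × Fin m → F)}
    (hK : IsQuasiCyclic K) {f : F[X]} {a : CyclicRing F m} (ha : a ∈ minIdeal m f)
    {u : Fin s → CyclicRing F m} (hu : u ∈ K.map phi) : a • u ∈ constituent K f :=
  ⟨hK.smul_mem_map_phi a hu, fun _ => Ideal.mul_mem_right _ _ ha⟩

theorem dvd_of_hermitianForm_constituent [NeZero m] (hm : (m : F) ≠ 0)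
    {K : Submodule F (Fin s × Fin m → F)} (hK : IsQuasiCyclic K) {f : F[X]}
    (hf : f ∣ X ^ m - 1)
    (h : ∀ u ∈ constituent K f, ∀ v ∈ constituent K f.reverse, hermitianForm u v = 0)
    {u v : Fin s → CyclicRing F m} (hu : u ∈ K.map phi) (hv : v ∈ K.map phi) {p : F[X]}
    (hp : hermitianForm u v = AdjoinRoot.mk _ p) : f ∣ p := by
  obtain ⟨q, hq⟩ := id hf
  have hsep : (X ^ m - 1 : F[X]).Separable := X_pow_sub_one_separable_iff.2 hm
  have hne : (X ^ m - 1 : F[X]) ≠ 0 := hsep.ne_zero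
  have hmem : AdjoinRoot.mk (X ^ m - 1 : F[X]) q ∈ minIdeal m f := by
    rw [minIdeal_eq_span hq]
    exact Ideal.mem_span_singleton_self _
  have h0 := h _ (smul_mem_constituent hK hmem hu) _
    (smul_mem_constituent hK (conj_mem_minIdeal_reverse hf hmem) hv)
  -- The second factor `q` is the double conjugate of `q`, from `conj q` acting on `v`.
  have h1 : AdjoinRoot.mk (X ^ m - 1 : F[X]) (q * q * p) = 0 := by
    rw [map_mul, map_mul, ← hp, ← h0, hermitianForm, hermitianForm, Finset.mul_sum]
    refine Finset.sum_congr rfl fun i _ => ?_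
    simp only [Pi.smul_apply, smul_eq_mul, map_mul, conj_conj]
    ring
  rw [AdjoinRoot.mk_eq_zero] at h1
  rw [hq] at hsep hne
  have h2 : q * f ∣ q * (q * p) := by
    rw [← mul_assoc, mul_comm q f, ← hq]
    exact h1
  exact hsep.isCoprime.dvd_of_dvd_mul_left
    ((mul_dvd_mul_iff_left (right_ne_zero_of_mul hne)).1 h2)

/-- Write `P = d q` with `d = gcd(P, p)`. An irreducible factor of `q` would also divide `d`, so its
square would divide `P`. -/
theorem dvd_of_squarefree_of_irreducible_dvd {P p : F[X]} (hP : Squarefree P)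
    (h : ∀ f : F[X], Irreducible f → f ∣ P → f ∣ p) : P ∣ p := by
  classical
  obtain ⟨d, ⟨q, rfl⟩, hdp, hd⟩ : ∃ d, d ∣ P ∧ d ∣ p ∧ ∀ f, f ∣ P → f ∣ p → f ∣ d :=
    ⟨EuclideanDomain.gcd P p, EuclideanDomain.gcd_dvd_left P p,
      EuclideanDomain.gcd_dvd_right P p, fun _ => EuclideanDomain.dvd_gcd⟩
  by_cases hu : IsUnit q
  · exact hu.mul_right_dvd.2 hdp
  · obtain ⟨f, hf, hfq⟩ :=
      WfDvdMonoid.exists_irreducible_factor hu (right_ne_zero_of_mul hP.ne_zero)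
    have hfP : f ∣ d * q := hfq.mul_left _
    exact absurd (hP f (mul_dvd_mul (hd f hfP (h f hf hfP)) hfq)) hf.not_isUnit

end Form

/-! ### The projection code and the constituent at `x - 1`. -/

section Projection

variable {F : Type*} [Field F] {s m : ℕ}

theorem projectionCode_eq [NeZero m] (hm : (m : F) ≠ 0) (K : Submodule F (Fin s × Fin m → F)) :
    projectionCode K = evalOneCode (constituent K (X - 1)) := by
  have hphi : ∀ (v : Fin s × Fin m → F) (a : Fin s → F), (∀ i k, v (i, k) = a i) →
      ∀ i, phi v i = a i • allOnes F m := by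
    intro v a hv i
    rw [phi_apply, blockPoly, allOnes, Finset.smul_sum]
    exact Finset.sum_congr rfl fun k _ => by rw [hv]
  ext a
  constructor
  · rintro ⟨v, hv, hva⟩
    -- The entries of `φ(v)` are `a i • allOnes`, which evaluate to `m * a i`; hence the factor
    -- `m⁻¹`.
    refine ⟨phi ((m : F)⁻¹ • v), ⟨⟨_, K.smul_mem _ hv.1, rfl⟩, fun i => ?_⟩, ?_⟩
    · rw [map_smul, Pi.smul_apply, hphi v a hva, smul_smul]
      exact mem_minIdeal_X_sub_one_iff.2 ⟨_, rfl⟩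
    · funext i
      change evalOne F m (phi ((m : F)⁻¹ • v) i) = a i
      rw [map_smul, Pi.smul_apply, hphi v a hva, smul_smul, map_smul, evalOne_allOnes,
        smul_eq_mul]
      field_simp
  · rintro ⟨u, ⟨⟨v, hv, rfl⟩, hu⟩, rfl⟩
    choose c hc using fun i => mem_minIdeal_X_sub_one_iff.1 (hu i)
    -- A word whose image lies in multiples of `allOnes` is constant on blocks, hence fixed by the
    -- shift.
    have hvc : v = fun p => c p.1 :=
      phi_injective (funext fun i => (hc i).trans (hphi _ c (fun _ _ => rfl) i).symm)
    refine ⟨(m : F) • v, ⟨K.smul_mem _ hv, by rw [hvc]; rfl⟩, fun i k => ?_⟩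
    change (m : F) * v (i, k) = evalOne F m (phi v i)
    rw [hc, map_smul, evalOne_allOnes, smul_eq_mul, hvc, mul_comm]

/-- Evaluation at `1` ignores conjugation, so it turns the form into the Euclidean product; it loses
nothing on the ideal at `x - 1`. -/
theorem isEuclideanSelfOrthogonal_evalOneCode [NeZero m] (hm : (m : F) ≠ 0)
    (K : Submodule F (Fin s × Fin m → F)) :
    IsEuclideanSelfOrthogonal (evalOneCode (constituent K (X - 1))) ↔
      ∀ u ∈ constituent K (X - 1), ∀ v ∈ constituent K (X - 1), hermitianForm u v = 0 := by
  have key : ∀ u v : Fin s → CyclicRing F m, evalOne F m (hermitianForm u v) =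
      (fun i => evalOne F m (u i)) ⬝ᵥ fun i => evalOne F m (v i) := by
    intro u v
    simp [hermitianForm, dotProduct, evalOne_conj]
  constructor
  · intro h u hu v hv
    refine eq_zero_of_evalOne_eq_zero hm
      (Ideal.sum_mem _ fun i _ => Ideal.mul_mem_right _ _ (hu.2 i)) ?_
    rw [key]
    exact h ⟨u, hu, rfl⟩ _ ⟨v, hv, rfl⟩
  · rintro h _ ⟨u, hu, rfl⟩ _ ⟨v, hv, rfl⟩
    exact (key u v).symm.trans (by rw [h u hu v hv, map_zero])

end Projection

section Duals

variable {F : Type*} [Field F] {s m : ℕ}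

theorem constituent_le_hermitianDualIn_iff (K : Submodule F (Fin s × Fin m → F)) (f : F[X]) :
    constituent K f ≤ hermitianDualIn (minIdeal m f) (constituent K f) ↔
      ∀ u ∈ constituent K f, ∀ v ∈ constituent K f, hermitianForm u v = 0 :=
  ⟨fun h u hu v hv => (h hu).2 v hv, fun h _ hu => ⟨hu.2, h _ hu⟩⟩

/-- The form is the Euclidean product with the conjugate word; double reversal places that conjugate
in the ideal at `f`. -/
theorem conjCode_le_euclideanDualIn_iff [NeZero m]
    (K : Submodule F (Fin s × Fin m → F)) {f : F[X]} (hf : f ∣ X ^ m - 1) :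
    conjCode (constituent K f.reverse) ≤ euclideanDualIn (minIdeal m f) (constituent K f) ↔
      ∀ u ∈ constituent K f, ∀ v ∈ constituent K f.reverse, hermitianForm u v = 0 := by
  constructor
  · intro h u hu v hv
    refine Eq.trans ?_ ((h ⟨v, hv, rfl⟩).2 _ hu)
    exact Finset.sum_congr rfl fun i _ => mul_comm _ _
  · rintro h _ ⟨v, hv, rfl⟩
    refine ⟨fun i => ?_, fun u hu => ?_⟩
    · obtain ⟨q, hq⟩ := id hf
      rw [← reverse_reverse_of_dvd hf]
      exact conj_mem_minIdeal_reverse (Dvd.intro _ (eq_reverse_mul_neg_reverse hq).symm) (hv.2 i)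
    · refine Eq.trans ?_ (h u hu v hv)
      exact Finset.sum_congr rfl fun i _ => mul_comm _ _

end Duals

end QuasiCyclic

open QuasiCyclic in
theorem mainTheorem6 {F : Type*} [Field F] [Fintype F] (s m : ℕ)
    (hm : Nat.gcd m (Fintype.card F) = 1)
    -- the factorization `x ^ m - 1 = δ g_0 g_1 ⋯ g_r h_1 h_1^* ⋯ h_t h_t^*`
    (r t : ℕ) (δ : F) (hδ : δ ≠ 0) (g : Fin (r + 1) → F[X]) (h : Fin t → F[X])
    (hg0 : g 0 = X - 1)
    (hg_irr : ∀ i, Irreducible (g i)) (hh_irr : ∀ j, Irreducible (h j))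
    (hg_rec : ∀ i, Associated (g i) (g i).reverse)
    (hfac : (X ^ m - 1 : F[X]) = C δ * (∏ i, g i) * ∏ j, (h j * (h j).reverse))
    (K : Submodule F (Fin s × Fin m → F)) (hK : QuasiCyclic.IsQuasiCyclic K) :
    QuasiCyclic.projectionCode K =
        QuasiCyclic.evalOneCode (QuasiCyclic.constituent K (g 0)) ∧
      (QuasiCyclic.IsEuclideanSelfOrthogonal K ↔
        QuasiCyclic.IsEuclideanSelfOrthogonal (QuasiCyclic.projectionCode K) ∧
        (∀ i : Fin (r + 1), i ≠ 0 →
          QuasiCyclic.constituent K (g i) ≤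
            QuasiCyclic.hermitianDualIn (QuasiCyclic.minIdeal m (g i))
              (QuasiCyclic.constituent K (g i))) ∧
        (∀ j : Fin t,
          QuasiCyclic.conjCode (QuasiCyclic.constituent K (h j).reverse) ≤
            QuasiCyclic.euclideanDualIn (QuasiCyclic.minIdeal m (h j))
              (QuasiCyclic.constituent K (h j)))) := by
  -- Otherwise the characteristic would divide both `m` and `q`.
  have hmF : (m : F) ≠ 0 := by
    intro h0
    obtain ⟨n, hp, hc⟩ := FiniteField.card F (ringChar F)
    have h1 : ringChar F ∣ Nat.gcd m (Fintype.card F) :=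
      Nat.dvd_gcd ((ringChar.spec F m).1 h0) (hc ▸ dvd_pow_self _ n.ne_zero)
    rw [hm] at h1
    exact hp.one_lt.ne' (Nat.dvd_one.1 h1)
  have : NeZero m := ⟨by rintro rfl; exact hmF Nat.cast_zero⟩
  have hg_dvd : ∀ i, g i ∣ X ^ m - 1 := fun i => by
    rw [hfac]
    exact ((Finset.dvd_prod_of_mem g (Finset.mem_univ i)).mul_left _).mul_right _
  have hhh_dvd : ∀ j, h j * (h j).reverse ∣ X ^ m - 1 := fun j => by
    rw [hfac]
    exact (Finset.dvd_prod_of_mem (fun j => h j * (h j).reverse) (Finset.mem_univ j)).mul_left _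
  have hh_dvd : ∀ j, h j ∣ X ^ m - 1 := fun j => (dvd_mul_right _ _).trans (hhh_dvd j)
  have hh'_dvd : ∀ j, (h j).reverse ∣ X ^ m - 1 := fun j => (dvd_mul_left _ _).trans (hhh_dvd j)
  have hproj := projectionCode_eq hmF K
  refine ⟨by rw [hg0, hproj], ?_⟩
  rw [hproj, isEuclideanSelfOrthogonal_evalOneCode hmF,
    isEuclideanSelfOrthogonal_iff_hermitianForm hK]
  simp only [constituent_le_hermitianDualIn_iff, conjCode_le_euclideanDualIn_iff K (hh_dvd _)]
  constructor
  · intro H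
    exact ⟨fun u hu v hv => H u hu.1 v hv.1, fun _ _ u hu v hv => H u hu.1 v hv.1,
      fun _ u hu v hv => H u hu.1 v hv.1⟩
  · rintro ⟨H0, Hg, Hh⟩ u hu v hv
    obtain ⟨p, hp⟩ := AdjoinRoot.mk_surjective (hermitianForm u v)
    have hg_p : ∀ i, g i ∣ p := fun i => by
      refine dvd_of_hermitianForm_constituent hmF hK (hg_dvd i) ?_ hu hv hp.symm
      -- Self-reciprocity makes the paired constituent the constituent itself.
      have hc : constituent K (g i).reverse = constituent K (g i) := by
        rw [constituent, ← minIdeal_congr (hg_dvd i) (hg_rec i), constituent]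
      rw [hc]
      by_cases hi : i = 0
      · rw [hi, hg0]; exact H0
      · exact Hg i hi
    have hh_p : ∀ j, h j ∣ p := fun j =>
      dvd_of_hermitianForm_constituent hmF hK (hh_dvd j) (Hh j) hu hv hp.symm
    have hh'_p : ∀ j, (h j).reverse ∣ p := fun j => by
      refine dvd_of_hermitianForm_constituent hmF hK (hh'_dvd j) ?_ hu hv hp.symm
      rw [reverse_reverse_of_dvd (hh_dvd j)]
      -- Conjugation swaps the arguments of the form, so the condition at `h_j^*` is the one at
      -- `h_j`.
      intro a ha b hb
      rw [← conj_conj (hermitianForm a b), ← map_zero (conj F m), ← Hh j b hb a ha]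
      simp only [hermitianForm, map_sum, map_mul, conj_conj, mul_comm]
    rw [← hp, AdjoinRoot.mk_eq_zero]
    -- Each irreducible factor of `x ^ m - 1` divides some listed factor, and all of those divide
    -- `p`.
    refine dvd_of_squarefree_of_irreducible_dvd (X_pow_sub_one_separable_iff.2 hmF).squarefree
      fun f hf hfP => ?_
    rw [hfac] at hfP
    rcases hf.prime.dvd_or_dvd hfP with hf1 | hf1
    · rcases hf.prime.dvd_or_dvd hf1 with hf2 | hf2
      · exact absurd (isUnit_of_dvd_unit hf2 (isUnit_C.2 hδ.isUnit)) hf.not_isUnit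
      · obtain ⟨i, -, hi⟩ := hf.prime.exists_mem_finset_dvd hf2
        exact hi.trans (hg_p i)
    · obtain ⟨j, -, hj⟩ := hf.prime.exists_mem_finset_dvd hf1
      rcases hf.prime.dvd_or_dvd hj with hj | hj
      · exact hj.trans (hh_p j)
      · exact hj.trans (hh'_p j)
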